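/- Let $n \ge 2$. Write $SU_n$ for the special unitary group and $\mathfrak{su}_n$ for its Lie algebra, the real vector space of traceless skew-Hermitian complex $n\times n$ matrices, on which $SU_n$ acts by the adjoint representation $\mathrm{Ad}_g X = gXg^{-1}$. For a real representation $V$ of a group $G$, let $s^2(V)$ be its symmetric square and let $\mathrm{Hom}_G(s^2(V),V)$ be the real vector space of $G$-equivariant linear maps $s^2(V)\to V$; such maps are written as symmetric bilinear maps $V\times V\to V$. (a) Let $G = SU_n\times SU_n$ act on $\mathfrak g = \mathfrak{su}_n\oplus\mathfrak{su}_n$ by the adjoint representation $(g,h)\cdot(X,Y) = (gXg^{-1},hYh^{-1})$. Then $$\dim_{\mathbb R}\mathrm{Hom}_G(s^2(\mathfrak g),\mathfrak g)=\begin{cases}0 & n=2,\\ 2 & n\ge 3.\end{cases}$$ (b) For $n\ge 3$, the two maps $$\psi_1\big((X,Y),(X',Y')\big)=\sqrt{-1}\,\Big((XX'+X'X)-\tfrac1n\mathrm{tr}(XX'+X'X)\,\mathrm{Id},\;0\Big),$$ $$\psi_2\big((X,Y),(X',Y')\big)=\sqrt{-1}\,\Big(0,\;(YY'+Y'Y)-\tfrac1n\mathrm{tr}(YY'+Y'Y)\,\mathrm{Id}\Big)$$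 form a basis of $\mathrm{Hom}_G(s^2(\mathfrak g),\mathfrak g)$. (c) For $n\ge 3$, let $\tau(X,Y)=(Y,X)$ be the swap on $\mathfrak g$. The subspace of those $\psi\in\mathrm{Hom}_G(s^2(\mathfrak g),\mathfrak g)$ that are invariant under $\tau$, that is, $\tau\big(\psi(\tau a,\tau b)\big)=\psi(a,b)$ for all $a,b\in\mathfrak g$, is one-dimensional and is spanned by $\Psi:=\psi_1+\psi_2$. (d) For the group $SU_n$ acting on $\mathfrak{su}_n$ by the adjoint representation, $$\dim_{\mathbb R}\mathrm{Hom}_{SU_n}(s^2(\mathfrak{su}_n),\mathfrak{su}_n)=\begin{cases}0 & n=2,\\ 1 & n\ge 3.\end{cases}$$ -/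

import Mathlib

open scoped TensorProduct Matrix

noncomputable section

namespace SUHom

/-! ### The symmetric square of a real representation -/

section SymmetricSquare

variable {V W : Type*} [AddCommGroup V] [Module ℝ V] [AddCommGroup W] [Module ℝ W]

/-- The product `x · y` of two vectors in the symmetric square `s²(V)`. -/
def symMul (x y : V) : Sym[ℝ]^2 V := SymmetricPower.tprod ℝ ![x, y]

/-- A bilinear map, as a multilinear map in two variables. -/
def multilinearOfBilin (B : V →ₗ[ℝ] V →ₗ[ℝ] W) : MultilinearMap ℝ (fun _ : Fin 2 => V) W where
  toFun v := B (v 0) (v 1)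
  map_update_add' v i x y := by
    fin_cases i <;> simp
  map_update_smul' v i c x := by
    fin_cases i <;> simp

/-- The linear map `s²(V) → W`, `x · y ↦ B(x, y)`, induced by a symmetric bilinear map `B`. -/
def symLift (B : V →ₗ[ℝ] V →ₗ[ℝ] W) (hB : ∀ x y, B x y = B y x) : Sym[ℝ]^2 V →ₗ[ℝ] W where
  __ := AddCon.lift (addConGen (SymmetricPower.Rel ℝ (Fin 2) V))
    (PiTensorProduct.lift (multilinearOfBilin B)).toAddMonoidHom
    (AddCon.addConGen_le.2 (by
      rintro _ _ ⟨e, f⟩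
      rw [AddCon.ker_rel]
      refine (PiTensorProduct.lift.tprod (φ := multilinearOfBilin B) f).trans
        (Eq.trans ?_ (PiTensorProduct.lift.tprod (φ := multilinearOfBilin B) fun i => f (e i)).symm)
      change B (f 0) (f 1) = B (f (e 0)) (f (e 1))
      have h01 : e 0 ≠ e 1 := fun h => absurd (e.injective h) (by decide)
      generalize e 0 = a at *
      generalize e 1 = b at *
      fin_cases a <;> fin_cases b
      · exact absurd rfl h01
      · rfl
      · exact hB _ _
      · exact absurd rfl h01))
  map_smul' c x := by
    induction x using AddCon.induction_on with
    | H x => exact (PiTensorProduct.lift (multilinearOfBilin B)).map_smul c x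

theorem symLift_symMul (B : V →ₗ[ℝ] V →ₗ[ℝ] W) (hB : ∀ x y, B x y = B y x) (x y : V) :
    symLift B hB (symMul x y) = B x y := by
  change PiTensorProduct.lift (multilinearOfBilin B) (PiTensorProduct.tprod ℝ ![x, y]) = _
  rw [PiTensorProduct.lift.tprod]
  rfl

/-- Two linear maps on `s²(V)` that agree on all products `x · y` are equal. -/
theorem symSq_hom_ext {f g : Sym[ℝ]^2 V →ₗ[ℝ] W}
    (h : ∀ x y, f (symMul x y) = g (symMul x y)) : f = g := by
  refine LinearMap.ext_on_range (v := SymmetricPower.tprod ℝ (ι := Fin 2) (M := V))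
    (SymmetricPower.span_tprod_eq_top ℝ (Fin 2) V) fun v => ?_
  have hv : v = ![v 0, v 1] := by
    ext i; fin_cases i <;> rfl
  rw [hv]
  exact h _ _

theorem symMul_comm (x y : V) : symMul x y = symMul y x := by
  have h := SymmetricPower.tprod_equiv (R := ℝ) (Equiv.swap (0 : Fin 2) 1) ![y, x]
  have h2 : (fun i => (![y, x] : Fin 2 → V) (Equiv.swap (0 : Fin 2) 1 i)) = ![x, y] := by
    ext i; fin_cases i <;> simp
  rw [h2] at h
  exact h

theorem symMul_add_left (x x' y : V) : symMul (x + x') y = symMul x y + symMul x' y := by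
  have h := (SymmetricPower.tprod ℝ (ι := Fin 2) (M := V)).map_update_add ![x, y] 0 x x'
  have e : ∀ z, Function.update ![x, y] 0 z = ![z, y] := fun z => by
    ext i; fin_cases i <;> rfl
  rwa [e, e, e] at h

theorem symMul_smul_left (c : ℝ) (x y : V) : symMul (c • x) y = c • symMul x y := by
  have h := (SymmetricPower.tprod ℝ (ι := Fin 2) (M := V)).map_update_smul ![x, y] 0 c x
  have e : ∀ z, Function.update ![x, y] 0 z = ![z, y] := fun z => by
    ext i; fin_cases i <;> rfl
  rwa [e, e] at h

/-- The product `V × V → s²(V)` as a bilinear map. -/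
def symMulBilin : V →ₗ[ℝ] V →ₗ[ℝ] Sym[ℝ]^2 V :=
  LinearMap.mk₂ ℝ symMul symMul_add_left symMul_smul_left
    (fun x y y' => by
      rw [symMul_comm, symMul_add_left, symMul_comm y, symMul_comm y'])
    (fun c x y => by rw [symMul_comm, symMul_smul_left, symMul_comm y])

/-- The linear map `s²(f) : s²(V) → s²(W)`, `x · y ↦ f(x) · f(y)`. -/
def symSqMap (f : V →ₗ[ℝ] W) : Sym[ℝ]^2 V →ₗ[ℝ] Sym[ℝ]^2 W :=
  symLift (symMulBilin.compl₁₂ f f) fun x y => symMul_comm (f x) (f y)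

theorem symSqMap_symMul (f : V →ₗ[ℝ] W) (x y : V) :
    symSqMap f (symMul x y) = symMul (f x) (f y) :=
  symLift_symMul _ _ x y

/-- The representation `s²(V)`, with action `g (x · y) = (g x) · (g y)`. -/
def symSqRep {G : Type*} [Group G] (ρ : Representation ℝ G V) :
    Representation ℝ G (Sym[ℝ]^2 V) where
  toFun g := symSqMap (ρ g)
  map_one' := symSq_hom_ext fun x y => by simp [symSqMap_symMul]
  map_mul' g h := symSq_hom_ext fun x y => by simp [symSqMap_symMul]

/-- `Hom_G(s²(V), V)`: the real vector space of `G`-equivariant linear maps `s²(V) → V`. -/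
abbrev HomSq {G : Type*} [Group G] (ρ : Representation ℝ G V) : Type _ :=
  (symSqRep ρ).IntertwiningMap ρ

/-- A `G`-equivariant symmetric bilinear map `V × V → V`, as an element of `Hom_G(s²(V), V)`. -/
def HomSq.ofBilin {G : Type*} [Group G] (ρ : Representation ℝ G V) (B : V →ₗ[ℝ] V →ₗ[ℝ] V)
    (hB : ∀ x y, B x y = B y x) (hρ : ∀ g x y, B (ρ g x) (ρ g y) = ρ g (B x y)) : HomSq ρ where
  toLinearMap := symLift B hB
  isIntertwining' g := symSq_hom_ext fun x y => by
    change symLift B hB (symSqMap (ρ g) (symMul x y)) = ρ g (symLift B hB (symMul x y))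
    rw [symSqMap_symMul, symLift_symMul, symLift_symMul, hρ]

theorem HomSq.ofBilin_symMul {G : Type*} [Group G] (ρ : Representation ℝ G V)
    (B : V →ₗ[ℝ] V →ₗ[ℝ] V) (hB : ∀ x y, B x y = B y x)
    (hρ : ∀ g x y, B (ρ g x) (ρ g y) = ρ g (B x y)) (x y : V) :
    HomSq.ofBilin ρ B hB hρ (symMul x y) = B x y :=
  symLift_symMul B hB x y

end SymmetricSquare

/-! ### The special unitary group and its adjoint representation -/

/-- The special unitary group `SU_n`. -/
abbrev SU (n : ℕ) : Type := Matrix.specialUnitaryGroup (Fin n) ℂ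

/-- The Lie algebra `su_n` of `SU_n`: the real vector space of traceless skew-Hermitian complex
`n × n` matrices. Its bracket (the commutator) plays no role below. -/
def su (n : ℕ) : Submodule ℝ (Matrix (Fin n) (Fin n) ℂ) where
  carrier := {X | Xᴴ = -X ∧ X.trace = 0}
  add_mem' := by
    rintro X Y ⟨hX, hX'⟩ ⟨hY, hY'⟩
    refine ⟨?_, ?_⟩
    · rw [Matrix.conjTranspose_add, hX, hY, neg_add]
    · rw [Matrix.trace_add, hX', hY', add_zero]
  zero_mem' := by simp
  smul_mem' := by
    rintro c X ⟨hX, hX'⟩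
    refine ⟨?_, ?_⟩
    · rw [Matrix.conjTranspose_smul, hX, star_trivial, smul_neg]
    · rw [Matrix.trace_smul, hX', smul_zero]

theorem SU_mul_inv {n : ℕ} (g : SU n) :
    (g : Matrix (Fin n) (Fin n) ℂ) * ((g⁻¹ : SU n) : Matrix (Fin n) (Fin n) ℂ) = 1 :=
  congrArg Subtype.val (mul_inv_cancel g)

theorem SU_inv_mul {n : ℕ} (g : SU n) :
    ((g⁻¹ : SU n) : Matrix (Fin n) (Fin n) ℂ) * (g : Matrix (Fin n) (Fin n) ℂ) = 1 :=
  congrArg Subtype.val (inv_mul_cancel g)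

theorem SU_trace_conj {n : ℕ} (g : SU n) (X : Matrix (Fin n) (Fin n) ℂ) :
    ((g : Matrix (Fin n) (Fin n) ℂ) * X * ((g⁻¹ : SU n) : Matrix (Fin n) (Fin n) ℂ)).trace
      = X.trace := by
  rw [Matrix.trace_mul_comm, ← mul_assoc, SU_inv_mul, one_mul]

/-- The adjoint representation of `SU_n` on `su_n`: `Ad_g X = g X g⁻¹`. -/
def adSU (n : ℕ) : Representation ℝ (SU n) (su n) where
  toFun g :=
    { toFun X := ⟨g * X * (g⁻¹ : SU n), by
        refine ⟨?_, ?_⟩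
        · have h1 : ((g⁻¹ : SU n) : Matrix (Fin n) (Fin n) ℂ)
              = (g : Matrix (Fin n) (Fin n) ℂ)ᴴ := rfl
          have h2 : (X : Matrix (Fin n) (Fin n) ℂ)ᴴ = -X := X.2.1
          rw [h1, Matrix.conjTranspose_mul, Matrix.conjTranspose_mul,
            Matrix.conjTranspose_conjTranspose, h2]
          noncomm_ring
        · rw [SU_trace_conj]
          exact X.2.2⟩
      map_add' X Y := Subtype.ext (by simp [mul_add, add_mul])
      map_smul' c X := Subtype.ext (by simp) }
  map_one' := LinearMap.ext fun X => Subtype.ext (by simp)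
  map_mul' g h := LinearMap.ext fun X => Subtype.ext (by simp [mul_assoc])

/-- The adjoint representation of `SU_n × SU_n` on its Lie algebra `su_n ⊕ su_n`:
`Ad_(g,h) (X, Y) = (g X g⁻¹, h Y h⁻¹)`. -/
def adSUSU (n : ℕ) : Representation ℝ (SU n × SU n) (su n × su n) where
  toFun g := (adSU n g.1).prodMap (adSU n g.2)
  map_one' := by ext <;> simp
  map_mul' g h := by ext <;> simp

/-! ### The maps `ψ₁`, `ψ₂` and the swap -/

/-- The matrix `√-1 ((X X' + X' X) - (1/n) tr(X X' + X' X) Id)`. -/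
def jordanMatrix {n : ℕ} (X X' : Matrix (Fin n) (Fin n) ℂ) : Matrix (Fin n) (Fin n) ℂ :=
  Complex.I • ((X * X' + X' * X) - ((1 / (n : ℂ)) * (X * X' + X' * X).trace) • 1)

theorem jordanMatrix_mem {n : ℕ} {X X' : Matrix (Fin n) (Fin n) ℂ} (hX : X ∈ su n)
    (hX' : X' ∈ su n) : jordanMatrix X X' ∈ su n := by
  have hH : (X * X' + X' * X)ᴴ = X * X' + X' * X := by
    rw [Matrix.conjTranspose_add, Matrix.conjTranspose_mul, Matrix.conjTranspose_mul, hX.1, hX'.1]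
    noncomm_ring
  refine ⟨?_, ?_⟩
  · have ht : star (X * X' + X' * X).trace = (X * X' + X' * X).trace := by
      rw [← Matrix.trace_conjTranspose, hH]
    rw [jordanMatrix, Matrix.conjTranspose_smul, Matrix.conjTranspose_sub, hH,
      Matrix.conjTranspose_smul, star_mul', ht]
    simp
  · rcases Nat.eq_zero_or_pos n with rfl | hn
    · simp [Matrix.trace]
    · have hn' : (n : ℂ) ≠ 0 := by exact_mod_cast hn.ne'
      rw [jordanMatrix, Matrix.trace_smul, Matrix.trace_sub, Matrix.trace_smul, Matrix.trace_one,
        Fintype.card_fin, smul_eq_mul, smul_eq_mul]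
      field_simp
      simp

/-- The bilinear map `(X, X') ↦ √-1 ((X X' + X' X) - (1/n) tr(X X' + X' X) Id)` on `su_n`. -/
def jordan (n : ℕ) : su n →ₗ[ℝ] su n →ₗ[ℝ] su n :=
  LinearMap.mk₂ ℝ (fun X X' => ⟨jordanMatrix X X', jordanMatrix_mem X.2 X'.2⟩)
    (fun X Y Z => Subtype.ext (by
      simp only [jordanMatrix, Submodule.coe_add, add_mul, mul_add, Matrix.trace_add]
      module))
    (fun c X Y => Subtype.ext (by
      simp only [jordanMatrix, Submodule.coe_smul, smul_mul_assoc, mul_smul_comm,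
        ← smul_add, Matrix.trace_smul]
      rw [smul_comm c Complex.I, smul_sub c, smul_sub, smul_sub, smul_assoc c]))
    (fun X Y Z => Subtype.ext (by
      simp only [jordanMatrix, Submodule.coe_add, add_mul, mul_add, Matrix.trace_add]
      module))
    (fun c X Y => Subtype.ext (by
      simp only [jordanMatrix, Submodule.coe_smul, smul_mul_assoc, mul_smul_comm,
        ← smul_add, Matrix.trace_smul]
      rw [smul_comm c Complex.I, smul_sub c, smul_sub, smul_sub, smul_assoc c]))

theorem jordan_comm {n : ℕ} (X X' : su n) : jordan n X X' = jordan n X' X :=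
  Subtype.ext (by simp only [jordan, LinearMap.mk₂_apply, jordanMatrix, add_comm])

theorem jordanMatrix_conj {n : ℕ} (g : SU n) (X X' : Matrix (Fin n) (Fin n) ℂ) :
    jordanMatrix ((g : Matrix (Fin n) (Fin n) ℂ) * X * ((g⁻¹ : SU n) : Matrix (Fin n) (Fin n) ℂ))
        ((g : Matrix (Fin n) (Fin n) ℂ) * X' * ((g⁻¹ : SU n) : Matrix (Fin n) (Fin n) ℂ))
      = (g : Matrix (Fin n) (Fin n) ℂ) * jordanMatrix X X'
          * ((g⁻¹ : SU n) : Matrix (Fin n) (Fin n) ℂ) := by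
  have h1 := SU_mul_inv g
  have h2 := SU_inv_mul g
  have h3 := SU_trace_conj g (X * X' + X' * X)
  generalize (g : Matrix (Fin n) (Fin n) ℂ) = a at *
  generalize ((g⁻¹ : SU n) : Matrix (Fin n) (Fin n) ℂ) = b at *
  have key : ∀ A B : Matrix (Fin n) (Fin n) ℂ, (a * A * b) * (a * B * b) = a * (A * B) * b := by
    intro A B
    calc (a * A * b) * (a * B * b) = a * A * (b * a) * B * b := by simp only [mul_assoc]
      _ = a * (A * B) * b := by rw [h2]; simp only [mul_assoc, one_mul]
  rw [jordanMatrix, jordanMatrix, key, key, ← add_mul, ← mul_add, h3, mul_smul_comm,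
    smul_mul_assoc, mul_sub, sub_mul, mul_smul_comm, smul_mul_assoc, mul_one, h1]

theorem jordan_equivariant {n : ℕ} (g : SU n) (X X' : su n) :
    jordan n (adSU n g X) (adSU n g X') = adSU n g (jordan n X X') :=
  Subtype.ext (jordanMatrix_conj g X X')

/-- `ψ₁((X, Y), (X', Y')) = √-1 ((X X' + X' X) - (1/n) tr(X X' + X' X) Id, 0)`. -/
def psi₁ (n : ℕ) : HomSq (adSUSU n) :=
  HomSq.ofBilin (adSUSU n)
    (((jordan n).compl₁₂ (LinearMap.fst ℝ (su n) (su n)) (LinearMap.fst ℝ (su n) (su n))).compr₂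
      (LinearMap.inl ℝ (su n) (su n)))
    (fun x y => by simp [jordan_comm x.1 y.1])
    (fun g x y => by simp [adSUSU, jordan_equivariant])

/-- `ψ₂((X, Y), (X', Y')) = √-1 (0, (Y Y' + Y' Y) - (1/n) tr(Y Y' + Y' Y) Id)`. -/
def psi₂ (n : ℕ) : HomSq (adSUSU n) :=
  HomSq.ofBilin (adSUSU n)
    (((jordan n).compl₁₂ (LinearMap.snd ℝ (su n) (su n)) (LinearMap.snd ℝ (su n) (su n))).compr₂
      (LinearMap.inr ℝ (su n) (su n)))
    (fun x y => by simp [jordan_comm x.2 y.2])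
    (fun g x y => by simp [adSUSU, jordan_equivariant])

theorem psi₁_apply (n : ℕ) (x x' : su n × su n) :
    psi₁ n (symMul x x') = (⟨jordanMatrix x.1 x'.1, jordanMatrix_mem x.1.2 x'.1.2⟩, 0) :=
  HomSq.ofBilin_symMul _ _ _ _ x x'

theorem psi₂_apply (n : ℕ) (x x' : su n × su n) :
    psi₂ n (symMul x x') = (0, ⟨jordanMatrix x.2 x'.2, jordanMatrix_mem x.2.2 x'.2.2⟩) :=
  HomSq.ofBilin_symMul _ _ _ _ x x'

/-- The involution `(X, Y) ↦ (Y, X)` of `su_n ⊕ su_n`. -/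
def swap (n : ℕ) : su n × su n →ₗ[ℝ] su n × su n :=
  (LinearEquiv.prodComm ℝ (su n) (su n)).toLinearMap

/-- The subspace of the maps `φ` in `Hom_G(s²(su_n ⊕ su_n), su_n ⊕ su_n)` that are invariant
under the swap `τ`, which acts by `φ ↦ τ ∘ φ ∘ s²(τ)`; recall that `τ` is its own inverse. -/
def swapInvariants (n : ℕ) : Submodule ℝ (HomSq (adSUSU n)) where
  carrier := {φ | swap n ∘ₗ φ.toLinearMap ∘ₗ symSqMap (swap n) = φ.toLinearMap}
  add_mem' := by
    intro φ φ' h h'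
    change swap n ∘ₗ (φ.toLinearMap + φ'.toLinearMap) ∘ₗ symSqMap (swap n)
      = φ.toLinearMap + φ'.toLinearMap
    rw [LinearMap.add_comp, LinearMap.comp_add, h, h']
  zero_mem' := by
    change swap n ∘ₗ (0 : Sym[ℝ]^2 (su n × su n) →ₗ[ℝ] su n × su n) ∘ₗ symSqMap (swap n) = 0
    simp
  smul_mem' := by
    intro c φ h
    change swap n ∘ₗ (c • φ.toLinearMap) ∘ₗ symSqMap (swap n) = c • φ.toLinearMap
    rw [LinearMap.smul_comp, LinearMap.comp_smul, h]

end SUHom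

end

noncomputable section

namespace SUHom

/-! ### Elements of the special unitary group -/

/-! An equivariant symmetric bilinear map `B` on `su n` is determined by its values `B X X`
(polarization), hence by its values on diagonal matrices (spectral theorem). These are spanned by
the vectors `diagGen j`, which have sum zero and are permuted transitively on ordered pairs of
distinct indices, so one value `Z = B (diagGen a) (diagGen b)` with `a ≠ b` determines `B`. Sign
changes force `Z` to be diagonal, permutations fixing or exchanging `a` and `b` force its entries to
agree at `a`, `b` and at all other places, and trace zero leaves the single imaginary number `Z a a`
(`bilin_eq_zero_of_apply`). For `n = 2` trace zero kills it as well; for `n ≥ 3` the map `jordan n`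
realizes it (`jordan_diagGen_apply`). Hence `exists_eq_smul_jordan`.

On the sum of two copies, the factor of the group that acts trivially on some arguments kills the
mixed blocks, since `su n` has neither nonzero invariants nor nonzero invariant functionals. The two
pure blocks are multiples of `jordan n`, and the swap exchanges their coefficients. -/

theorem coe_adSU {n : ℕ} (g : SU n) (X : su n) :
    (adSU n g X : Matrix (Fin n) (Fin n) ℂ)
      = (g : Matrix (Fin n) (Fin n) ℂ) * X * (g : Matrix (Fin n) (Fin n) ℂ)ᴴ := rfl

/-- Conjugation by a unitary matrix is the adjoint action of an element of `SU_n`. -/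
theorem exists_adSU_eq_conj {n : ℕ} (hn : n ≠ 0) {U : Matrix (Fin n) (Fin n) ℂ}
    (hU : U ∈ Matrix.unitaryGroup (Fin n) ℂ) :
    ∃ g : SU n, ∀ X : su n, (adSU n g X : Matrix (Fin n) (Fin n) ℂ) = U * X * Uᴴ := by
  have hdet : ‖U.det‖ = 1 :=
    CStarRing.norm_of_mem_unitary (Matrix.det_of_mem_unitary hU)
  -- Rescaling `U` by an `n`-th root of the conjugate of its determinant makes the determinant 1.
  -- This root has modulus 1, so it cancels in the conjugation.
  obtain ⟨ζ, hζ⟩ := IsAlgClosed.exists_pow_nat_eq (star U.det) (Nat.pos_of_ne_zero hn)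
  have hζ1 : ‖ζ‖ = 1 := by
    have h : ‖ζ‖ ^ n = 1 := by rw [← norm_pow, hζ, norm_star, hdet]
    exact (pow_eq_one_iff_of_nonneg (norm_nonneg ζ) hn).1 h
  have hζζ : ζ * star ζ = 1 := by
    rw [Complex.star_def, Complex.mul_conj, Complex.normSq_eq_norm_sq, hζ1]
    simp
  refine ⟨⟨ζ • U, Matrix.mem_specialUnitaryGroup_iff.2 ⟨?_, ?_⟩⟩, fun X => ?_⟩
  · rw [Matrix.mem_unitaryGroup_iff, star_smul, smul_mul_smul_comm, hζζ,
      Matrix.mem_unitaryGroup_iff.1 hU, one_smul]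
  · rw [Matrix.det_smul, Fintype.card_fin, hζ]
    exact (Unitary.mem_iff.1 (Matrix.det_of_mem_unitary hU)).1
  · rw [coe_adSU, Matrix.conjTranspose_smul, smul_mul_assoc, smul_mul_smul_comm, hζζ, one_smul]

/-- The permutation matrices act on `su_n` by simultaneous permutation of rows and columns. -/
theorem exists_adSU_perm {n : ℕ} (hn : n ≠ 0) (σ : Equiv.Perm (Fin n)) :
    ∃ g : SU n, ∀ (X : su n) (i j : Fin n),
      (adSU n g X : Matrix (Fin n) (Fin n) ℂ) i j
        = (X : Matrix (Fin n) (Fin n) ℂ) (σ i) (σ j) := by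
  have hU : σ.permMatrix ℂ ∈ Matrix.unitaryGroup (Fin n) ℂ := by
    rw [Matrix.mem_unitaryGroup_iff, Matrix.star_eq_conjTranspose, Matrix.conjTranspose_permMatrix,
      ← Matrix.permMatrix_mul]
    simp
  obtain ⟨g, hg⟩ := exists_adSU_eq_conj hn hU
  refine ⟨g, fun X i j => ?_⟩
  rw [hg, Matrix.conjTranspose_permMatrix, PEquiv.toMatrix_toPEquiv_mul,
    PEquiv.mul_toMatrix_toPEquiv]
  rfl

/-- Some element of `SU_n` acts on `su_n` by changing the sign of the row `i` and the column `i`. -/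
theorem exists_adSU_sign {n : ℕ} (hn : n ≠ 0) (i : Fin n) :
    ∃ g : SU n, ∀ (X : su n) (j k : Fin n),
      (adSU n g X : Matrix (Fin n) (Fin n) ℂ) j k
        = (if j = i then -1 else 1) * (X : Matrix (Fin n) (Fin n) ℂ) j k
          * (if k = i then -1 else 1) := by
  have hU : Matrix.diagonal (fun k => if k = i then (-1 : ℂ) else 1)
      ∈ Matrix.unitaryGroup (Fin n) ℂ := by
    rw [Matrix.mem_unitaryGroup_iff, Matrix.star_eq_conjTranspose,
      Matrix.diagonal_conjTranspose, Matrix.diagonal_mul_diagonal, ← Matrix.diagonal_one]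
    congr 1
    ext k
    by_cases h : k = i <;> simp [h]
  obtain ⟨g, hg⟩ := exists_adSU_eq_conj hn hU
  refine ⟨g, fun X j k => ?_⟩
  rw [hg, Matrix.diagonal_conjTranspose, Matrix.mul_diagonal, Matrix.diagonal_mul]
  by_cases h : k = i <;> simp [h]

/-! ### The diagonal matrices in `su_n` -/

/-- The diagonal matrix `√-1 (E_jj - (1/n) Id)` in `su_n`. -/
def diagGen {n : ℕ} (j : Fin n) : su n :=
  ⟨Matrix.diagonal fun k => Complex.I * ((if k = j then 1 else 0) - 1 / (n : ℂ)), by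
    refine ⟨?_, ?_⟩
    · rw [Matrix.diagonal_conjTranspose, Matrix.diagonal_neg]
      congr 1
      ext k
      by_cases h : k = j <;> simp [h]
    · have hn : (n : ℂ) ≠ 0 := by
        have := j.pos
        exact_mod_cast this.ne'
      rw [Matrix.trace_diagonal, ← Finset.mul_sum, Finset.sum_sub_distrib]
      simp [hn]⟩

theorem coe_diagGen {n : ℕ} (j : Fin n) : (diagGen j : Matrix (Fin n) (Fin n) ℂ)
    = Matrix.diagonal fun k => Complex.I * ((if k = j then 1 else 0) - 1 / (n : ℂ)) := rfl

/-- This relation turns permutation symmetry into vanishing statements: it is used for functionals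
and for the values `B (diagGen i) (diagGen i)`. -/
theorem sum_diagGen (n : ℕ) : ∑ j : Fin n, diagGen j = 0 := by
  ext i k
  have hn : (n : ℂ) ≠ 0 := by
    have := i.pos
    exact_mod_cast this.ne'
  rw [AddSubmonoidClass.coe_finsetSum, Matrix.sum_apply]
  by_cases h : i = k
  · subst h
    simp only [coe_diagGen, Matrix.diagonal_apply_eq]
    rw [← Finset.mul_sum, Finset.sum_sub_distrib]
    simp [hn]
  · simp [coe_diagGen, Matrix.diagonal_apply_ne _ h]

theorem adSU_diagGen_of_perm {n : ℕ} {g : SU n} {σ : Equiv.Perm (Fin n)}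
    (hg : ∀ (X : su n) (i j : Fin n), (adSU n g X : Matrix (Fin n) (Fin n) ℂ) i j
        = (X : Matrix (Fin n) (Fin n) ℂ) (σ i) (σ j)) (j : Fin n) :
    adSU n g (diagGen (σ j)) = diagGen j := by
  ext i k
  rw [hg]
  simp [coe_diagGen, Matrix.diagonal_apply]

theorem adSU_diagGen_of_sign {n : ℕ} {g : SU n} {i : Fin n}
    (hg : ∀ (X : su n) (j k : Fin n), (adSU n g X : Matrix (Fin n) (Fin n) ℂ) j k
        = (if j = i then -1 else 1) * (X : Matrix (Fin n) (Fin n) ℂ) j k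
          * (if k = i then -1 else 1)) (j : Fin n) :
    adSU n g (diagGen j) = diagGen j := by
  ext k l
  rw [hg]
  by_cases h : k = l
  · subst h
    by_cases h' : k = i <;> simp [h']
  · simp [coe_diagGen, Matrix.diagonal_apply_ne _ h]

/-- Every element of `su_n` is conjugate to a diagonal one. -/
theorem exists_eq_adSU_diag {n : ℕ} (hn : n ≠ 0) (X : su n) :
    ∃ (g : SU n) (c : Fin n → ℝ), X = adSU n g (∑ j, c j • diagGen j) := by
  have hX : (X : Matrix (Fin n) (Fin n) ℂ)ᴴ = -X := X.2.1
  have hA : ((-Complex.I) • (X : Matrix (Fin n) (Fin n) ℂ)).IsHermitian := by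
    rw [Matrix.IsHermitian, Matrix.conjTranspose_smul, hX]
    simp
  obtain ⟨g, hg⟩ := exists_adSU_eq_conj hn hA.eigenvectorUnitary.2
  refine ⟨g, hA.eigenvalues, ?_⟩
  -- Since the eigenvalues sum to zero, the `1 / n` terms in the `diagGen j` cancel in the
  -- combination below.
  have htr : ∑ j, (hA.eigenvalues j : ℂ) = 0 := by
    have h := hA.trace_eq_sum_eigenvalues
    rw [Matrix.trace_smul, X.2.2, smul_zero] at h
    exact h.symm
  have hD : ((∑ j, hA.eigenvalues j • diagGen j : su n) : Matrix (Fin n) (Fin n) ℂ)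
      = Complex.I • Matrix.diagonal (RCLike.ofReal ∘ hA.eigenvalues) := by
    ext i k
    rw [AddSubmonoidClass.coe_finsetSum, Matrix.sum_apply]
    by_cases h : i = k
    · subst h
      simp only [coe_diagGen, Submodule.coe_smul, Matrix.smul_apply, Matrix.diagonal_apply_eq,
        Complex.real_smul, smul_eq_mul, Function.comp_apply]
      simp only [mul_left_comm _ Complex.I, ← Finset.mul_sum, mul_sub, Finset.sum_sub_distrib,
        ← Finset.sum_mul, htr]
      simp
    · simp [coe_diagGen, Matrix.diagonal_apply_ne _ h]
  apply Subtype.ext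
  rw [hg, hD, mul_smul_comm, smul_mul_assoc]
  have hs := hA.spectral_theorem
  rw [Unitary.conjStarAlgAut_apply] at hs
  rw [← Matrix.star_eq_conjTranspose]
  erw [← hs]
  rw [smul_smul]
  simp

/-! ### Invariants and coinvariants of `su_n` -/

/-- If a matrix of `su_n` is fixed by the sign change at `i`, then its row `i` is zero off the
diagonal. -/
theorem apply_eq_zero_of_sign {n : ℕ} {X : su n} {i j : Fin n} (hij : i ≠ j) {g : SU n}
    (hg : ∀ (X : su n) (j k : Fin n), (adSU n g X : Matrix (Fin n) (Fin n) ℂ) j k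
        = (if j = i then -1 else 1) * (X : Matrix (Fin n) (Fin n) ℂ) j k
          * (if k = i then -1 else 1)) (hX : adSU n g X = X) :
    (X : Matrix (Fin n) (Fin n) ℂ) i j = 0 := by
  have h := hg X i j
  rw [hX] at h
  simp only [hij.symm, if_true, if_false, mul_one, neg_mul, one_mul] at h
  exact self_eq_neg.1 h

/-- Permutations make the diagonal constant, so trace zero kills it; sign changes kill the other
entries. -/
theorem eq_zero_of_adSU_invariant {n : ℕ} (hn : n ≠ 0) {X : su n} (hX : ∀ g, adSU n g X = X) :
    X = 0 := by
  have hnC : (n : ℂ) ≠ 0 := by exact_mod_cast hn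
  have hdiag : ∀ i j, (X : Matrix (Fin n) (Fin n) ℂ) i i = (X : Matrix (Fin n) (Fin n) ℂ) j j := by
    intro i j
    obtain ⟨g, hg⟩ := exists_adSU_perm hn (Equiv.swap i j)
    have h := hg X i i
    rwa [hX, Equiv.swap_apply_left] at h
  ext i j
  by_cases hij : i = j
  · subst hij
    have htr : (X : Matrix (Fin n) (Fin n) ℂ).trace = 0 := X.2.2
    simp only [Matrix.trace, Matrix.diag_apply, hdiag _ i, Finset.sum_const, Finset.card_univ,
      Fintype.card_fin, nsmul_eq_mul, mul_eq_zero, hnC, false_or] at htr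
    exact htr
  · obtain ⟨g, hg⟩ := exists_adSU_sign hn i
    exact apply_eq_zero_of_sign hij hg (hX g)

/-- Permutations give `f` the same value on all `diagGen j`. These sum to zero, so the value is
zero, and every orbit meets their span. -/
theorem eq_zero_of_comp_adSU {n : ℕ} (hn : n ≠ 0) {W : Type*} [AddCommGroup W] [Module ℝ W]
    {f : su n →ₗ[ℝ] W} (hf : ∀ g X, f (adSU n g X) = f X) : f = 0 := by
  have hconst : ∀ i j : Fin n, f (diagGen i) = f (diagGen j) := by
    intro i j
    obtain ⟨g, hg⟩ := exists_adSU_perm hn (Equiv.swap i j)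
    have h := adSU_diagGen_of_perm hg j
    rw [Equiv.swap_apply_right] at h
    rw [← h, hf]
  have hzero : ∀ i : Fin n, f (diagGen i) = 0 := by
    intro i
    have h : f (∑ j : Fin n, diagGen j) = 0 := by rw [sum_diagGen, map_zero]
    rw [map_sum, Finset.sum_congr rfl fun j _ => hconst j i, Finset.sum_const, Finset.card_univ,
      Fintype.card_fin, ← Nat.cast_smul_eq_nsmul ℝ, smul_eq_zero] at h
    exact h.resolve_left (by exact_mod_cast hn)
  ext X
  obtain ⟨g, c, rfl⟩ := exists_eq_adSU_diag hn X
  simp [hf, hzero]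

/-! ### Equivariant symmetric bilinear maps on `su_n` -/

section Bilinear

variable {n : ℕ} {B : su n →ₗ[ℝ] su n →ₗ[ℝ] su n}

theorem bilin_eq_zero_of_diagGen (hn : n ≠ 0) (hB : ∀ x y, B x y = B y x)
    (hρ : ∀ g x y, B (adSU n g x) (adSU n g y) = adSU n g (B x y))
    {a b : Fin n} (hab : a ≠ b) (h : B (diagGen a) (diagGen b) = 0) : B = 0 := by
  have hne : ∀ i j : Fin n, i ≠ j → B (diagGen i) (diagGen j) = 0 := by
    intro i j hij
    obtain ⟨σ, hσa, hσb⟩ : ∃ σ : Equiv.Perm (Fin n), σ i = a ∧ σ j = b := by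
      -- The first transposition sends `i` to `a`; the second sends the image of `j` to `b` and
      -- fixes `a`.
      refine ⟨(Equiv.swap i a).trans (Equiv.swap (Equiv.swap i a j) b), ?_, ?_⟩
      · have h1 : a ≠ Equiv.swap i a j := fun h => hij (by
          exact (Equiv.swap i a).injective ((Equiv.swap_apply_left i a).trans h))
        simp [Equiv.swap_apply_of_ne_of_ne h1 hab]
      · simp
    obtain ⟨g, hg⟩ := exists_adSU_perm hn σ
    rw [← adSU_diagGen_of_perm hg i, ← adSU_diagGen_of_perm hg j, hρ, hσa, hσb, h, map_zero]
  have heq : ∀ i j : Fin n, B (diagGen i) (diagGen j) = 0 := by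
    intro i j
    by_cases hij : i = j
    · subst hij
      -- In the expansion of this zero sum only the term `j = i` can survive.
      have hs : B (diagGen i) (∑ j : Fin n, diagGen j) = 0 := by rw [sum_diagGen, map_zero]
      rwa [map_sum, Finset.sum_eq_single i (fun j _ hj => hne i j hj.symm) (by simp)] at hs
    · exact hne i j hij
  have hdiag : ∀ X, B X X = 0 := by
    intro X
    obtain ⟨g, c, rfl⟩ := exists_eq_adSU_diag hn X
    rw [hρ]
    simp [heq]
  ext X Y : 2
  -- Polarization: the quadratic form vanishes, hence so does the symmetric bilinear map.
  have h2 := hdiag (X + Y)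
  simp only [map_add, LinearMap.add_apply, hdiag, zero_add, add_zero, hB Y X] at h2
  rw [← two_smul ℝ] at h2
  rw [(smul_eq_zero.1 h2).resolve_left two_ne_zero]
  rfl

/-- The transposition of `a` and `b` exchanges the two arguments, so by symmetry of `B` it fixes the
value. -/
theorem bilin_diagGen_apply_swap (hn : n ≠ 0) (hB : ∀ x y, B x y = B y x)
    (hρ : ∀ g x y, B (adSU n g x) (adSU n g y) = adSU n g (B x y)) (a b : Fin n) :
    (B (diagGen a) (diagGen b) : Matrix (Fin n) (Fin n) ℂ) b b
      = (B (diagGen a) (diagGen b) : Matrix (Fin n) (Fin n) ℂ) a a := by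
  obtain ⟨g, hg⟩ := exists_adSU_perm hn (Equiv.swap a b)
  have ha := adSU_diagGen_of_perm hg a
  have hb := adSU_diagGen_of_perm hg b
  rw [Equiv.swap_apply_left] at ha
  rw [Equiv.swap_apply_right] at hb
  have h := hg (B (diagGen a) (diagGen b)) b b
  rwa [← hρ, ha, hb, hB, Equiv.swap_apply_right] at h

/-- An equivariant symmetric bilinear map on `su_n` is determined by a single matrix entry. -/
theorem bilin_eq_zero_of_apply (hn : n ≠ 0) (hB : ∀ x y, B x y = B y x)
    (hρ : ∀ g x y, B (adSU n g x) (adSU n g y) = adSU n g (B x y))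
    {a b : Fin n} (hab : a ≠ b)
    (h : (B (diagGen a) (diagGen b) : Matrix (Fin n) (Fin n) ℂ) a a = 0) : B = 0 := by
  refine bilin_eq_zero_of_diagGen hn hB hρ hab ?_
  set Z := B (diagGen a) (diagGen b) with hZ
  have hb : (Z : Matrix (Fin n) (Fin n) ℂ) b b = 0 :=
    (bilin_diagGen_apply_swap hn hB hρ a b).trans h
  -- Both arguments are fixed by every sign change, hence so is `Z`.
  have hoff : ∀ i j, i ≠ j → (Z : Matrix (Fin n) (Fin n) ℂ) i j = 0 := by
    intro i j hij
    obtain ⟨g, hg⟩ := exists_adSU_sign hn i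
    refine apply_eq_zero_of_sign hij hg ?_
    rw [hZ, ← hρ, adSU_diagGen_of_sign hg, adSU_diagGen_of_sign hg]
  -- Transpositions away from `a` and `b` fix both arguments, hence `Z`.
  have hconst : ∀ i j, i ≠ a → i ≠ b → j ≠ a → j ≠ b →
      (Z : Matrix (Fin n) (Fin n) ℂ) i i = (Z : Matrix (Fin n) (Fin n) ℂ) j j := by
    intro i j hia hib hja hjb
    obtain ⟨g, hg⟩ := exists_adSU_perm hn (Equiv.swap i j)
    have ha' := adSU_diagGen_of_perm hg a
    have hb' := adSU_diagGen_of_perm hg b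
    rw [Equiv.swap_apply_of_ne_of_ne hia.symm hja.symm] at ha'
    rw [Equiv.swap_apply_of_ne_of_ne hib.symm hjb.symm] at hb'
    have h1 := hg Z i i
    rwa [hZ, ← hρ, ha', hb', ← hZ, Equiv.swap_apply_left] at h1
  have htr : ∑ j, (Z : Matrix (Fin n) (Fin n) ℂ) j j = 0 := Z.2.2
  ext i j
  by_cases hij : i = j
  · subst hij
    by_cases hia : i = a
    · rw [hia]; exact h
    by_cases hib : i = b
    · rw [hib]; exact hb
    -- The trace is thus the entry at `i` times the number of indices other than `a` and `b`, a
    -- number that is positive because `i` is one of them.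
    have hsum : ∀ j, (Z : Matrix (Fin n) (Fin n) ℂ) j j
        = if j ∈ ({a, b} : Finset (Fin n)) then 0 else (Z : Matrix (Fin n) (Fin n) ℂ) i i := by
      intro j
      by_cases hja : j = a
      · simp [hja, h]
      by_cases hjb : j = b
      · simp [hjb, hb]
      simp [hja, hjb, hconst j i hja hjb hia hib]
    rw [Finset.sum_congr rfl fun j _ => hsum j, Finset.sum_ite, Finset.sum_const_zero, zero_add,
      Finset.sum_const, smul_eq_zero, Finset.card_eq_zero] at htr
    refine htr.resolve_left fun h0 => ?_
    have : i ∈ Finset.filter (fun j => j ∉ ({a, b} : Finset (Fin n))) Finset.univ := by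
      simp [hia, hib]
    rw [h0] at this
    simp at this
  · exact hoff i j hij

/-- The factor `n - 2` is what separates `n = 2` from `n ≥ 3`. -/
theorem jordan_diagGen_apply {a b : Fin n} (hab : a ≠ b) :
    (jordan n (diagGen a) (diagGen b) : Matrix (Fin n) (Fin n) ℂ) a a
      = Complex.I * (2 * (n - 2) / (n : ℂ) ^ 2) := by
  have hnC : (n : ℂ) ≠ 0 := by
    have := a.pos
    exact_mod_cast this.ne'
  change jordanMatrix (diagGen a : Matrix (Fin n) (Fin n) ℂ) (diagGen b) a a = _
  have hcross : ∀ k : Fin n,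
      ((if k = a then (1 : ℂ) else 0) - 1 / n) * ((if k = b then (1 : ℂ) else 0) - 1 / n)
        = - (1 / n) * (if k = a then (1 : ℂ) else 0) - (1 / n) * (if k = b then (1 : ℂ) else 0)
          + (1 / n) ^ 2 := by
    intro k
    by_cases hka : k = a
    · subst hka
      simp [hab]; ring
    · by_cases hkb : k = b
      · simp [hkb, hab.symm]; ring
      · simp [hka, hkb]; ring
  have hprod : (diagGen a : Matrix (Fin n) (Fin n) ℂ) * (diagGen b : Matrix (Fin n) (Fin n) ℂ)
      + (diagGen b : Matrix (Fin n) (Fin n) ℂ) * (diagGen a : Matrix (Fin n) (Fin n) ℂ)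
      = Matrix.diagonal fun k : Fin n => (-2 : ℂ) * (- (1 / n) * (if k = a then (1 : ℂ) else 0)
        - (1 / n) * (if k = b then (1 : ℂ) else 0) + (1 / n) ^ 2) := by
    rw [coe_diagGen, coe_diagGen, Matrix.diagonal_mul_diagonal, Matrix.diagonal_mul_diagonal,
      Matrix.diagonal_add]
    congr 1
    ext k
    rw [← hcross k]
    linear_combination (2 * ((if k = a then (1 : ℂ) else 0) - 1 / n)
      * ((if k = b then (1 : ℂ) else 0) - 1 / n)) * Complex.I_sq
  rw [jordanMatrix, hprod, Matrix.trace_diagonal, ← Finset.mul_sum, Finset.sum_add_distrib,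
    Finset.sum_sub_distrib, ← Finset.mul_sum, ← Finset.mul_sum]
  simp [hab]
  field_simp
  ring

/-- For `n = 2` the two diagonal entries of the value are equal and have sum zero. -/
theorem bilin_eq_zero_two {B : su 2 →ₗ[ℝ] su 2 →ₗ[ℝ] su 2} (hB : ∀ x y, B x y = B y x)
    (hρ : ∀ g x y, B (adSU 2 g x) (adSU 2 g y) = adSU 2 g (B x y)) : B = 0 := by
  refine bilin_eq_zero_of_apply two_ne_zero hB hρ (zero_ne_one (α := Fin 2)) ?_
  have htr : Matrix.trace (B (diagGen 0) (diagGen 1) : Matrix (Fin 2) (Fin 2) ℂ) = 0 :=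
    (B (diagGen 0) (diagGen 1)).2.2
  rw [Matrix.trace_fin_two, bilin_diagGen_apply_swap two_ne_zero hB hρ 0 1] at htr
  exact add_self_eq_zero.1 htr

/-- Subtracting the multiple of `jordan n` with the same distinguished entry leaves a map to which
`bilin_eq_zero_of_apply` applies. -/
theorem exists_eq_smul_jordan (hn : 2 ≤ n) (hB : ∀ x y, B x y = B y x)
    (hρ : ∀ g x y, B (adSU n g x) (adSU n g y) = adSU n g (B x y)) :
    ∃ c : ℝ, B = c • jordan n := by
  have hn0 : n ≠ 0 := by omega
  have hab : (⟨0, by omega⟩ : Fin n) ≠ ⟨1, by omega⟩ := by simp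
  generalize (⟨0, by omega⟩ : Fin n) = a at hab
  generalize (⟨1, by omega⟩ : Fin n) = b at hab
  have key : ∀ c : ℝ, ((B + -c • jordan n) (diagGen a) (diagGen b) : Matrix (Fin n) (Fin n) ℂ)
      a a = 0 → B = c • jordan n := fun c hc =>
by
    have h0 := bilin_eq_zero_of_apply hn0
      (B := B + -c • jordan n) (fun x y => by simp [hB x y, jordan_comm x y])
      (fun g x y => by simp [hρ, jordan_equivariant]) hab hc
    ext x y : 2
    have h1 : B x y + -c • jordan n x y = 0 := LinearMap.congr_fun (LinearMap.congr_fun h0 x) y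
    have h2 : (B x y : Matrix (Fin n) (Fin n) ℂ) + -c • (jordan n x y : Matrix (Fin n) (Fin n) ℂ)
        = 0 := congrArg Subtype.val h1
    rw [neg_smul, ← sub_eq_add_neg] at h2
    exact Subtype.ext (sub_eq_zero.1 h2)
  -- Diagonal entries of skew-Hermitian matrices are imaginary, so the quotient by the entry of
  -- `jordan n` is real.
  have hanti : (B (diagGen a) (diagGen b) : Matrix (Fin n) (Fin n) ℂ) a a
      = Complex.I * ((B (diagGen a) (diagGen b) : Matrix (Fin n) (Fin n) ℂ) a a).im := by
    have h := congrFun (congrFun (B (diagGen a) (diagGen b)).2.1 a) a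
    have hre := congrArg Complex.re h
    simp only [Matrix.conjTranspose_apply, Matrix.neg_apply, Complex.star_def, Complex.conj_re,
      Complex.neg_re] at hre
    apply Complex.ext <;> simp
    linarith
  rcases hn.eq_or_lt with rfl | h3
  · refine ⟨0, ?_⟩
    rw [bilin_eq_zero_two hB hρ, zero_smul]
  · have hn2 : (n : ℝ) - 2 ≠ 0 := by
      have : (2 : ℝ) < n := by exact_mod_cast h3
      linarith
    have hnR : (n : ℝ) ≠ 0 := by exact_mod_cast hn0
    refine ⟨((B (diagGen a) (diagGen b) : Matrix (Fin n) (Fin n) ℂ) a a).im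
      / (2 * (n - 2) / (n : ℝ) ^ 2), key _ ?_⟩
    have hnC : (n : ℂ) ≠ 0 := by exact_mod_cast hn0
    have hn2C : (n : ℂ) - 2 ≠ 0 := by exact_mod_cast hn2
    simp only [LinearMap.add_apply, LinearMap.smul_apply, Submodule.coe_add, Submodule.coe_smul,
      Matrix.add_apply, Matrix.smul_apply, jordan_diagGen_apply hab, Complex.real_smul]
    rw [hanti]
    push_cast
    simp
    field_simp
    simp

theorem jordan_two : jordan 2 = 0 :=
  bilin_eq_zero_two jordan_comm jordan_equivariant

theorem jordan_ne_zero (hn : 3 ≤ n) : jordan n ≠ 0 := by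
  intro h
  have h1 := jordan_diagGen_apply (n := n) (a := ⟨0, by omega⟩) (b := ⟨1, by omega⟩) (by simp)
  rw [h] at h1
  have hnC : (n : ℂ) ≠ 0 := by exact_mod_cast (by omega : n ≠ 0)
  have hn2C : (n : ℂ) - 2 ≠ 0 := sub_ne_zero.2 (by exact_mod_cast (by omega : n ≠ 2))
  simp [hnC, hn2C] at h1

end Bilinear

/-! ### Equivariant maps on the symmetric square as bilinear maps -/

section ToBilin

variable {V : Type*} [AddCommGroup V] [Module ℝ V] {G : Type*} [Group G]
  {ρ : Representation ℝ G V}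

/-- The symmetric bilinear map `(x, y) ↦ φ(x · y)`. -/
def HomSq.toBilin (φ : HomSq ρ) : V →ₗ[ℝ] V →ₗ[ℝ] V := symMulBilin.compr₂ φ.toLinearMap

theorem HomSq.toBilin_apply (φ : HomSq ρ) (x y : V) : φ.toBilin x y = φ (symMul x y) := rfl

theorem HomSq.toBilin_comm (φ : HomSq ρ) (x y : V) : φ.toBilin x y = φ.toBilin y x := by
  rw [toBilin_apply, symMul_comm, toBilin_apply]

theorem HomSq.toBilin_equivariant (φ : HomSq ρ) (g : G) (x y : V) :
    φ.toBilin (ρ g x) (ρ g y) = ρ g (φ.toBilin x y) := by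
  have h := Representation.IntertwiningMap.isIntertwining _ _ φ g (symMul x y)
  change φ (symSqMap (ρ g) (symMul x y)) = _ at h
  rwa [symSqMap_symMul] at h

theorem HomSq.ext_symMul {φ ψ : HomSq ρ} (h : ∀ x y, φ (symMul x y) = ψ (symMul x y)) : φ = ψ :=
  Representation.IntertwiningMap.ext (symSq_hom_ext h)

end ToBilin

/-! ### The group `SU_n` -/

/-- The generator `(X, X') ↦ √-1 ((X X' + X' X) - (1/n) tr(X X' + X' X) Id)` of
`Hom_{SU_n}(s²(su_n), su_n)`. -/
def jordanHom (n : ℕ) : HomSq (adSU n) :=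
  HomSq.ofBilin (adSU n) (jordan n) jordan_comm jordan_equivariant

theorem jordanHom_symMul (n : ℕ) (x y : su n) : jordanHom n (symMul x y) = jordan n x y :=
  HomSq.ofBilin_symMul _ _ _ _ x y

theorem exists_eq_smul_jordanHom {n : ℕ} (hn : 2 ≤ n) (φ : HomSq (adSU n)) :
    ∃ c : ℝ, φ = c • jordanHom n := by
  obtain ⟨c, hc⟩ := exists_eq_smul_jordan hn φ.toBilin_comm φ.toBilin_equivariant
  refine ⟨c, HomSq.ext_symMul fun x y => ?_⟩
  rw [← HomSq.toBilin_apply, hc]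
  change c • jordan n x y = c • jordanHom n (symMul x y)
  rw [jordanHom_symMul]

theorem exists_jordan_apply_ne_zero {n : ℕ} (hn : 3 ≤ n) : ∃ x y : su n, jordan n x y ≠ 0 := by
  by_contra! h
  exact jordan_ne_zero hn (LinearMap.ext fun x => LinearMap.ext fun y => h x y)

theorem jordanHom_two : jordanHom 2 = 0 :=
  HomSq.ext_symMul fun x y => by
    rw [jordanHom_symMul, jordan_two]
    rfl

/-! ### The group `SU_n × SU_n` -/

theorem psi₁_symMul (n : ℕ) (x y : su n × su n) :
    psi₁ n (symMul x y) = (jordan n x.1 y.1, 0) := psi₁_apply n x y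

theorem psi₂_symMul (n : ℕ) (x y : su n × su n) :
    psi₂ n (symMul x y) = (0, jordan n x.2 y.2) := psi₂_apply n x y

theorem smul_psi_add_symMul (n : ℕ) (c d : ℝ) (x y : su n × su n) :
    (c • psi₁ n + d • psi₂ n) (symMul x y) = (c • jordan n x.1 y.1, d • jordan n x.2 y.2) := by
  change c • psi₁ n (symMul x y) + d • psi₂ n (symMul x y) = _
  rw [psi₁_symMul, psi₂_symMul]
  simp

section Components

variable {n : ℕ} (φ : HomSq (adSUSU n))

theorem HomSq.toBilin_adSUSU (g h : SU n) (x y : su n × su n) :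
    φ.toBilin (adSU n g x.1, adSU n h x.2) (adSU n g y.1, adSU n h y.2)
      = (adSU n g (φ.toBilin x y).1, adSU n h (φ.toBilin x y).2) :=
  φ.toBilin_equivariant (g, h) x y

/-- The second group factor fixes `(X, 0)` and the first component of the value, which is therefore
an invariant linear function of `Y`, hence zero. The second component is treated likewise, as a
function of `X`. -/
theorem HomSq.toBilin_inl_inr (hn : n ≠ 0) (X Y : su n) : φ.toBilin (X, 0) (0, Y) = 0 := by
  have h1 : LinearMap.fst ℝ (su n) (su n) ∘ₗ φ.toBilin (X, 0) ∘ₗ LinearMap.inr ℝ (su n) (su n)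
      = 0 := eq_zero_of_comp_adSU hn fun g Y => by
    have h := congrArg Prod.fst (φ.toBilin_adSUSU 1 g (X, 0) (0, Y))
    simpa using h
  have h2 : LinearMap.snd ℝ (su n) (su n) ∘ₗ φ.toBilin.flip (0, Y) ∘ₗ
      LinearMap.inl ℝ (su n) (su n) = 0 := eq_zero_of_comp_adSU hn fun g X => by
    have h := congrArg Prod.snd (φ.toBilin_adSUSU g 1 (X, 0) (0, Y))
    simpa using h
  exact Prod.ext (LinearMap.congr_fun h1 Y) (LinearMap.congr_fun h2 X)

/-- The second group factor fixes both arguments, so this component is an invariant vector of `su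
n`. -/
theorem HomSq.toBilin_inl_inl_snd (hn : n ≠ 0) (X X' : su n) :
    (φ.toBilin (X, 0) (X', 0)).2 = 0 :=
  eq_zero_of_adSU_invariant hn fun g => by
    have h := congrArg Prod.snd (φ.toBilin_adSUSU 1 g (X, 0) (X', 0))
    simpa using h.symm

theorem HomSq.toBilin_inr_inr_fst (hn : n ≠ 0) (Y Y' : su n) :
    (φ.toBilin (0, Y) (0, Y')).1 = 0 :=
  eq_zero_of_adSU_invariant hn fun g => by
    have h := congrArg Prod.fst (φ.toBilin_adSUSU g 1 (0, Y) (0, Y'))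
    simpa using h.symm

theorem HomSq.exists_toBilin_inl_inl (hn : 2 ≤ n) :
    ∃ c : ℝ, ∀ X X', φ.toBilin (X, 0) (X', 0) = (c • jordan n X X', 0) := by
  obtain ⟨c, hc⟩ := exists_eq_smul_jordan (n := n) hn
    (B := (φ.toBilin.compl₁₂ (LinearMap.inl ℝ (su n) (su n)) (LinearMap.inl ℝ (su n) (su n))).compr₂
      (LinearMap.fst ℝ (su n) (su n)))
    (fun x y => congrArg Prod.fst (φ.toBilin_comm (x, 0) (y, 0)))
    (fun g x y => by
      have h := congrArg Prod.fst (φ.toBilin_adSUSU g 1 (x, 0) (y, 0))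
      simpa using h)
  exact ⟨c, fun X X' => Prod.ext (LinearMap.congr_fun₂ hc X X')
    (φ.toBilin_inl_inl_snd (by omega) X X')⟩

theorem HomSq.exists_toBilin_inr_inr (hn : 2 ≤ n) :
    ∃ c : ℝ, ∀ Y Y', φ.toBilin (0, Y) (0, Y') = (0, c • jordan n Y Y') := by
  obtain ⟨c, hc⟩ := exists_eq_smul_jordan (n := n) hn
    (B := (φ.toBilin.compl₁₂ (LinearMap.inr ℝ (su n) (su n)) (LinearMap.inr ℝ (su n) (su n))).compr₂
      (LinearMap.snd ℝ (su n) (su n)))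
    (fun x y => congrArg Prod.snd (φ.toBilin_comm (0, x) (0, y)))
    (fun g x y => by
      have h := congrArg Prod.snd (φ.toBilin_adSUSU 1 g (0, x) (0, y))
      simpa using h)
  exact ⟨c, fun Y Y' => Prod.ext (φ.toBilin_inr_inr_fst (by omega) Y Y')
    (LinearMap.congr_fun₂ hc Y Y')⟩

theorem exists_eq_smul_psi_add (hn : 2 ≤ n) :
    ∃ c d : ℝ, φ = c • psi₁ n + d • psi₂ n := by
  obtain ⟨c, hc⟩ := φ.exists_toBilin_inl_inl hn
  obtain ⟨d, hd⟩ := φ.exists_toBilin_inr_inr hn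
  have hn0 : n ≠ 0 := by omega
  refine ⟨c, d, HomSq.ext_symMul fun x y => ?_⟩
  have hsplit : ∀ z : su n × su n, z = (z.1, 0) + (0, z.2) := fun z => by simp
  have h : φ.toBilin x y = (c • jordan n x.1 y.1, d • jordan n x.2 y.2) := by
    conv_lhs => rw [hsplit x, hsplit y]
    simp only [map_add, LinearMap.add_apply]
    rw [hc, hd, φ.toBilin_inl_inr hn0, φ.toBilin_comm (0, x.2), φ.toBilin_inl_inr hn0]
    simp
  rw [← HomSq.toBilin_apply, h, smul_psi_add_symMul]

end Components

theorem smul_psi_add_inj {n : ℕ} (hn : 3 ≤ n) {c d c' d' : ℝ}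
    (h : c • psi₁ n + d • psi₂ n = c' • psi₁ n + d' • psi₂ n) : c = c' ∧ d = d' := by
  obtain ⟨X, Y, hXY⟩ := exists_jordan_apply_ne_zero hn
  -- On diagonal pairs both components equal multiples of the same nonzero vector, so both
  -- coefficients can be read off.
  have h' := DFunLike.congr_fun h (symMul (X, X) (Y, Y))
  rw [smul_psi_add_symMul, smul_psi_add_symMul] at h'
  exact ⟨smul_left_injective ℝ hXY (congrArg Prod.fst h'),
    smul_left_injective ℝ hXY (congrArg Prod.snd h')⟩

theorem linearIndependent_psi {n : ℕ} (hn : 3 ≤ n) :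
    LinearIndependent ℝ ![psi₁ n, psi₂ n] :=
  LinearIndependent.pair_iffₛ.2 fun _ _ _ _ h => smul_psi_add_inj hn h

/-- `ψ₁, ψ₂` as a basis of `Hom_G(s²(su_n ⊕ su_n), su_n ⊕ su_n)`. -/
def psiBasis {n : ℕ} (hn : 3 ≤ n) : Module.Basis (Fin 2) ℝ (HomSq (adSUSU n)) :=
  Module.Basis.mk (linearIndependent_psi hn) fun φ _ => by
    obtain ⟨c, d, rfl⟩ := exists_eq_smul_psi_add φ (by omega)
    exact Submodule.add_mem _ (Submodule.smul_mem _ _ (Submodule.subset_span ⟨0, rfl⟩))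
      (Submodule.smul_mem _ _ (Submodule.subset_span ⟨1, rfl⟩))

theorem psi₁_two : psi₁ 2 = 0 :=
  HomSq.ext_symMul fun x y => by
    rw [psi₁_symMul, jordan_two]
    rfl

theorem psi₂_two : psi₂ 2 = 0 :=
  HomSq.ext_symMul fun x y => by
    rw [psi₂_symMul, jordan_two]
    rfl

/-! ### Invariance under the swap -/

theorem mem_swapInvariants_iff {n : ℕ} (φ : HomSq (adSUSU n)) :
    φ ∈ swapInvariants n ↔ ∀ x y, (φ (symMul x.swap y.swap)).swap = φ (symMul x y) := by
  have key : ∀ x y, (swap n ∘ₗ φ.toLinearMap ∘ₗ symSqMap (swap n)) (symMul x y)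
      = (φ (symMul x.swap y.swap)).swap := fun x y => by
    rw [LinearMap.comp_apply, LinearMap.comp_apply, symSqMap_symMul]
    rfl
  refine ⟨fun h x y => ?_, fun h => symSq_hom_ext fun x y => (key x y).trans (h x y)⟩
  rw [← key]
  exact LinearMap.congr_fun h _

/-- The swap exchanges `psi₁ n` and `psi₂ n`, hence the coefficients `c` and `d`. -/
theorem smul_psi_add_mem_swapInvariants_iff {n : ℕ} (hn : 3 ≤ n) (c d : ℝ) :
    c • psi₁ n + d • psi₂ n ∈ swapInvariants n ↔ c = d := by
  simp only [mem_swapInvariants_iff, smul_psi_add_symMul]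
  refine ⟨fun h => ?_, fun h x y => by subst h; rfl⟩
  obtain ⟨X, Y, hXY⟩ := exists_jordan_apply_ne_zero hn
  have h1 : d • jordan n X Y = c • jordan n X Y := congrArg Prod.fst (h (X, X) (Y, Y))
  exact (smul_left_injective ℝ hXY h1).symm

theorem swapInvariants_eq_span {n : ℕ} (hn : 3 ≤ n) :
    swapInvariants n = Submodule.span ℝ {psi₁ n + psi₂ n} := by
  apply le_antisymm
  · intro φ hφ
    obtain ⟨c, d, rfl⟩ := exists_eq_smul_psi_add φ (by omega)
    obtain rfl := (smul_psi_add_mem_swapInvariants_iff hn c d).1 hφ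
    exact Submodule.mem_span_singleton.2 ⟨c, smul_add _ _ _⟩
  · rw [Submodule.span_singleton_le_iff_mem]
    have h := (smul_psi_add_mem_swapInvariants_iff hn 1 1).2 rfl
    rwa [one_smul, one_smul] at h

/-! ### Dimensions -/

theorem rank_eq_one_of_smul {V : Type*} [AddCommMonoid V] [Module ℝ V] (v : V)
    (hinj : Function.Injective fun c : ℝ => c • v) (hsurj : ∀ w, ∃ c : ℝ, w = c • v) :
    Module.rank ℝ V = 1 := by
  have h := (LinearEquiv.ofBijective (LinearMap.toSpanSingleton ℝ V v)
    ⟨hinj, fun w => (hsurj w).imp fun _ => Eq.symm⟩).lift_rank_eq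
  rw [Module.rank_self, Cardinal.lift_one] at h
  exact Cardinal.lift_eq_one.1 h.symm

theorem rank_eq_zero_of_forall_eq_zero {V : Type*} [AddCommMonoid V] [Module ℝ V]
    (h : ∀ v : V, v = 0) : Module.rank ℝ V = 0 :=
  have : Subsingleton V := ⟨fun v w => (h v).trans (h w).symm⟩
  rank_subsingleton' ℝ V

theorem rank_swapInvariants {n : ℕ} (hn : 3 ≤ n) : Module.rank ℝ (swapInvariants n) = 1 := by
  have hmem : psi₁ n + psi₂ n ∈ swapInvariants n := by
    rw [swapInvariants_eq_span hn]
    exact Submodule.mem_span_singleton_self _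
  refine rank_eq_one_of_smul ⟨psi₁ n + psi₂ n, hmem⟩ (fun a b h => ?_) fun φ => ?_
  · have h' : a • (psi₁ n + psi₂ n) = b • (psi₁ n + psi₂ n) := congrArg Subtype.val h
    rw [smul_add, smul_add] at h'
    exact (smul_psi_add_inj hn h').1
  · obtain ⟨c, hc⟩ := Submodule.mem_span_singleton.1 ((swapInvariants_eq_span hn).le φ.2)
    exact ⟨c, Subtype.ext hc.symm⟩

theorem rank_homSq_adSU {n : ℕ} (hn : 3 ≤ n) : Module.rank ℝ (HomSq (adSU n)) = 1 := by
  refine rank_eq_one_of_smul (jordanHom n) (fun a b h => ?_)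
    (exists_eq_smul_jordanHom (by omega))
  obtain ⟨X, Y, hXY⟩ := exists_jordan_apply_ne_zero hn
  have h' : a • jordanHom n (symMul X Y) = b • jordanHom n (symMul X Y) :=
    DFunLike.congr_fun h (symMul X Y)
  rw [jordanHom_symMul] at h'
  exact smul_left_injective ℝ hXY h'

end SUHom

end

theorem mainTheorem6 (n : ℕ) (hn : 2 ≤ n) :
    -- the group `SU_n × SU_n`
    (n = 2 → Module.rank ℝ (SUHom.HomSq (SUHom.adSUSU n)) = 0) ∧
    (3 ≤ n → Module.rank ℝ (SUHom.HomSq (SUHom.adSUSU n)) = 2) ∧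
    (3 ≤ n → ∃ b : Module.Basis (Fin 2) ℝ (SUHom.HomSq (SUHom.adSUSU n)),
      b 0 = SUHom.psi₁ n ∧ b 1 = SUHom.psi₂ n) ∧
    (3 ≤ n → Module.rank ℝ (SUHom.swapInvariants n) = 1 ∧
      SUHom.swapInvariants n = Submodule.span ℝ {SUHom.psi₁ n + SUHom.psi₂ n}) ∧
    -- the group `SU_n`
    (n = 2 → Module.rank ℝ (SUHom.HomSq (SUHom.adSU n)) = 0) ∧
    (3 ≤ n → Module.rank ℝ (SUHom.HomSq (SUHom.adSU n)) = 1) := by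
  refine ⟨?_, fun h => ?_, fun h => ⟨SUHom.psiBasis h, ?_, ?_⟩,
    fun h => ⟨SUHom.rank_swapInvariants h, SUHom.swapInvariants_eq_span h⟩, ?_,
    fun h => SUHom.rank_homSq_adSU h⟩
  · rintro rfl
    refine SUHom.rank_eq_zero_of_forall_eq_zero fun φ => ?_
    obtain ⟨c, d, rfl⟩ := SUHom.exists_eq_smul_psi_add φ hn
    rw [SUHom.psi₁_two, SUHom.psi₂_two, smul_zero, smul_zero, add_zero]
  · rw [rank_eq_card_basis (SUHom.psiBasis h)]
    simp
  · rw [SUHom.psiBasis, Module.Basis.mk_apply]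
    rfl
  · rw [SUHom.psiBasis, Module.Basis.mk_apply]
    rfl
  · rintro rfl
    refine SUHom.rank_eq_zero_of_forall_eq_zero fun φ => ?_
    obtain ⟨c, rfl⟩ := SUHom.exists_eq_smul_jordanHom hn φ
    rw [SUHom.jordanHom_two, smul_zero]
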